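/- Let $G$ be a finite group with a proper nontrivial normal subgroup $N$ such that $(G,N)$ is a Camina pair, i.e. every $x \in G \setminus N$ is conjugate in $G$ to every element of the coset $xN$. Suppose that $(G,N)$ is of Type (4), i.e. there is a prime $p$ such that $G/N$ is a $p$-group, $p$ divides $|N|$, and $N$ is not a $p$-group. Then $F(G) < N$, i.e. the Fitting subgroup $F(G)$ of $G$ (the subgroup generated by all nilpotent normal subgroups of $G$) is properly contained in $N$. -/

import Mathlib

/-- `(G, N)` is a Camina pair: `N` is a proper nontrivial normal subgroup of `G`, and every
`x ∈ G \ N` is conjugate in `G` to every element of the coset `xN`. -/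
structure IsCaminaPair {G : Type*} [Group G] (N : Subgroup G) [N.Normal] : Prop where
  ne_bot : N ≠ ⊥
  ne_top : N ≠ ⊤
  isConj_mul : ∀ x : G, x ∉ N → ∀ n ∈ N, IsConj x (x * n)

/-- Camina pairs of Type (4): for some prime `p`, the quotient `G / N` is a `p`-group, `p` divides
the order of `N`, and `N` is not a `p`-group. -/
structure IsCaminaPairTypeFour {G : Type*} [Group G] (N : Subgroup G) [N.Normal] : Prop
    extends IsCaminaPair N where
  exists_prime : ∃ p : ℕ, p.Prime ∧ IsPGroup p (G ⧸ N) ∧ p ∣ Nat.card N ∧ ¬ IsPGroup p N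

/-- The Fitting subgroup `F(G)`: the subgroup generated by all nilpotent normal subgroups of `G`
(for finite `G`, the largest nilpotent normal subgroup). -/
def fittingSubgroup (G : Type*) [Group G] : Subgroup G :=
  sSup {H : Subgroup G | H.Normal ∧ Group.IsNilpotent H}

/-!
In a Camina pair every normal subgroup of `G` is comparable with `N`, so if `N` is not nilpotent,
then every nilpotent normal subgroup lies in `N`; the containment `F(G) ≤ N` is proper because
`F(G)` is nilpotent. Everything thus rests on `IsCaminaPair.not_isNilpotent`.

Suppose `N` is nilpotent, and let `K` be its normal `p`-complement, which is nontrivial because `N`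
is not a `p`-group. Every element outside `N` is conjugate to its own `p`-part, so it has `p`-power
order; consequently it commutes with no nontrivial `p'`-element of `N`. Hence the `p`-group `G / N`
acts fixed-point-freely on the nontrivial abelian `p'`-group `K ∩ Z(N)`. As in the theory of
Frobenius complements, `G / N` then has a unique subgroup of order `p`, and this subgroup is
contained in every nontrivial cyclic subgroup (`IsPGroup.exists_forall_mem_zpowers`). Let `x` be a
lift of one of its generators. Each `y ∉ N` has a power in `xN`, so the image of `x` in
`G / [N, G]`, where `N` becomes central, commutes with everything. But `x` is conjugate to `xn` for
all `n ∈ N`, which forces `[N, G] = N`. This is impossible: `N / K` is a nontrivial normal subgroup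
of the nilpotent group `G / K`, so `[N, G] K < N`.
-/

/-! ### Fixed-point-free actions of `p`-groups -/

open Finset in
/-- A noncyclic group of order `p²` cannot act without fixed points on a module on which `p` is
nonzero. The vanishing of the norm sums `∑ ρ h ^ i` expresses the absence of fixed points. If `x`
were outside `⟨y⟩`, summing the norms of the elements `x * y ^ i` over `i` would leave `p`, because
for `0 < j < p` the terms of degree `j` add up to a multiple of the norm of `y ^ j`. -/
theorem mem_zpowers_of_sum_pow_eq_zero {R H : Type*} [Ring R] [Group H] (ρ : H →* R) {p : ℕ}
    (hp : p.Prime) (hpR : (p : R) ≠ 0)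
    (hρ : ∀ h : H, h ≠ 1 → h ^ p = 1 → ∑ i ∈ range p, ρ h ^ i = 0)
    {x y : H} (hxy : Commute x y) (hx : x ^ p = 1) (hy : y ^ p = 1) (hy1 : y ≠ 1) :
    x ∈ Subgroup.zpowers y := by
  by_contra hmem
  have : Fact p.Prime := ⟨hp⟩
  have hord : orderOf y = p := orderOf_eq_prime hy hy1
  have h1 : ∀ i ∈ range p, ∑ j ∈ range p, ρ (x * y ^ i) ^ j = 0 := by
    intro i _
    apply hρ
    · intro h
      exact hmem (eq_inv_of_mul_eq_one_left h ▸ inv_mem (Subgroup.npow_mem_zpowers y i))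
    · rw [(hxy.pow_right i).mul_pow, hx, ← pow_mul, mul_comm, pow_mul, hy, one_pow, one_mul]
  have h2 : ∀ j ∈ range p, ∑ i ∈ range p, ρ (x * y ^ i) ^ j = if j = 0 then (p : R) else 0 := by
    intro j hj
    have e : ∀ i, ρ (x * y ^ i) ^ j = ρ x ^ j * ρ (y ^ j) ^ i := by
      intro i
      rw [← map_pow, (hxy.pow_right i).mul_pow, map_mul, map_pow, ← map_pow ρ (y ^ j), ← pow_mul,
        ← pow_mul, mul_comm i j]
    simp only [e]
    rw [← mul_sum]
    split_ifs with h
    · subst h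
      simp
    · rw [hρ, mul_zero]
      · intro hj1
        have := Nat.le_of_dvd (Nat.pos_of_ne_zero h) (hord ▸ orderOf_dvd_of_pow_eq_one hj1)
        exact absurd (mem_range.1 hj) (by omega)
      · rw [← pow_mul, mul_comm, pow_mul, hy, one_pow]
  have h3 := sum_eq_zero h1
  rw [sum_comm, sum_congr rfl h2, sum_ite_eq' (range p) 0, if_pos (mem_range.2 hp.pos)] at h3
  exact hpR h3

/-- A nontrivial finite `p`-group acting without fixed points, in the sense that norm sums vanish,
has an element `z ≠ 1` that is a power of every nontrivial element: any central `z` of order `p`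
will do. -/
theorem IsPGroup.exists_forall_mem_zpowers {R H : Type*} [Ring R] [Group H] [Finite H]
    [Nontrivial H] (ρ : H →* R) {p : ℕ} (hp : p.Prime) (hH : IsPGroup p H) (hpR : (p : R) ≠ 0)
    (hρ : ∀ h : H, h ≠ 1 → h ^ p = 1 → ∑ i ∈ Finset.range p, ρ h ^ i = 0) :
    ∃ z : H, z ≠ 1 ∧ ∀ y : H, y ≠ 1 → z ∈ Subgroup.zpowers y := by
  have : Fact p.Prime := ⟨hp⟩
  have hpow : ∀ K : Subgroup H, K ≠ ⊥ → ∃ z ∈ K, z ≠ 1 ∧ z ^ p = 1 := by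
    intro K hK
    have hdvd : p ∣ Nat.card K := (hH.to_subgroup K).card_eq_or_dvd.resolve_left
      (fun h => hK (Subgroup.card_eq_one.1 h))
    obtain ⟨z, hz⟩ := exists_prime_orderOf_dvd_card' p hdvd
    refine ⟨z, z.2, fun h => ?_, ?_⟩
    · rw [OneMemClass.coe_eq_one.1 h, orderOf_one] at hz
      exact hp.one_lt.ne hz
    · rw [← hz]
      exact_mod_cast congrArg Subtype.val (pow_orderOf_eq_one z)
  obtain ⟨z, hzc, hz1, hzp⟩ := hpow (Subgroup.center H) hH.bot_lt_center.ne'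
  refine ⟨z, hz1, fun y hy => ?_⟩
  obtain ⟨w, hwy, hw1, hwp⟩ := hpow (Subgroup.zpowers y) (by simpa using hy)
  exact Subgroup.zpowers_le.2 hwy (mem_zpowers_of_sum_pow_eq_zero ρ hp hpR hρ
    ((Subgroup.mem_center_iff.1 hzc w).symm) hzp hwp hw1)

open Finset in
/-- If an endomorphism `φ` with `φ ^ n = 1` has no nonzero fixed points, its norm sum vanishes,
since `φ` fixes every value of that sum. -/
theorem AddMonoid.End.sum_pow_eq_zero {A : Type*} [AddCommGroup A] {φ : AddMonoid.End A} {n : ℕ}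
    (hφ : φ ^ n = 1) (hfix : ∀ a, φ a = a → a = 0) : ∑ i ∈ range n, φ ^ i = 0 := by
  have h := mul_geom_sum φ n
  rw [hφ, sub_self, sub_mul, one_mul, sub_eq_zero] at h
  ext a
  exact hfix _ (DFunLike.congr_fun h a)

/-! ### Nilpotent groups and the Fitting subgroup -/

theorem Subgroup.eq_bot_of_commutator_top_eq {H : Type*} [Group H] [Group.IsNilpotent H]
    {A : Subgroup H} (hA : ⁅A, (⊤ : Subgroup H)⁆ = A) : A = ⊥ := by
  obtain ⟨n, hn⟩ := Subgroup.nilpotent_iff_lowerCentralSeries.1 ‹Group.IsNilpotent H›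
  have h : ∀ k, A ≤ (⊤ : Subgroup H).lowerCentralSeries k := by
    intro k
    induction k with
    | zero => exact le_top
    | succ k ih =>
      rw [Subgroup.lowerCentralSeries_succ]
      exact hA.ge.trans (Subgroup.commutator_mono ih le_rfl)
  exact le_bot_iff.1 (hn ▸ h n)

theorem Subgroup.inf_center_ne_bot {H : Type*} [Group H] [Group.IsNilpotent H]
    {A : Subgroup H} [A.Normal] (hA : A ≠ ⊥) : A ⊓ Subgroup.center H ≠ ⊥ := by
  classical
  obtain ⟨n, hn⟩ := Group.IsNilpotent.nilpotent H
  have hex : ∃ n, A ⊓ Subgroup.upperCentralSeries H n ≠ ⊥ := ⟨n, by rwa [hn, inf_top_eq]⟩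
  obtain ⟨k, hk⟩ : ∃ k, Nat.find hex = k + 1 := by
    refine Nat.exists_eq_succ_of_ne_zero fun h0 => Nat.find_spec hex ?_
    rw [h0, Subgroup.upperCentralSeries_zero, inf_bot_eq]
  have hbot : A ⊓ Subgroup.upperCentralSeries H k = ⊥ :=
    not_not.1 (Nat.find_min hex (hk ▸ Nat.lt_succ_self k))
  have hne := Nat.find_spec hex
  rw [hk] at hne
  obtain ⟨⟨x, hxA, hx⟩, hx1⟩ := (Subgroup.ne_bot_iff_exists_ne_one).1 hne
  intro h
  refine hx1 (Subtype.ext ((Subgroup.mem_bot).1 (h ▸ (⟨hxA, Subgroup.mem_center_iff.2 fun g => ?_⟩ :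
    x ∈ A ⊓ Subgroup.center H))))
  have h1 : x * g * x⁻¹ * g⁻¹ ∈ A ⊓ Subgroup.upperCentralSeries H k := by
    refine ⟨?_, Subgroup.mem_upperCentralSeries_succ_iff.1 hx g⟩
    rw [mul_assoc, mul_assoc]
    exact mul_mem hxA (by simpa [mul_assoc] using ‹A.Normal›.conj_mem _ (inv_mem hxA) g)
  rw [hbot, Subgroup.mem_bot] at h1
  exact (mul_inv_eq_iff_eq_mul.1 (mul_inv_eq_one.1 h1)).symm

/-- The normal `p`-complement `K` of a finite nilpotent group, obtained as the kernel of the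
projection onto the Sylow `p`-subgroup in the decomposition into Sylow subgroups. -/
theorem Group.IsNilpotent.exists_pComplement {N : Type*} [Group N] [Finite N]
    [hN : Group.IsNilpotent N] {p : ℕ} (hp : p.Prime) (hpN : p ∣ Nat.card N) :
    ∃ (m : ℕ) (K : Subgroup N), p.Coprime m ∧ K.Characteristic ∧ (∀ x ∈ K, x ^ m = 1) ∧
      ∀ x : N, ∃ k, x ^ p ^ k ∈ K := by
  have : Fact p.Prime := ⟨hp⟩
  obtain ⟨e⟩ := (Group.isNilpotent_of_finite_tfae (G := N).out 0 4 rfl rfl).1 hN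
  let p' : (Nat.card N).primeFactors := ⟨p, Nat.mem_primeFactors.2 ⟨hp, hpN, Nat.card_pos.ne'⟩⟩
  let P : Sylow p N := default
  let f : N →* P := ((Pi.evalMonoidHom _ P).comp (Pi.evalMonoidHom _ p')).comp e.symm.toMonoidHom
  have hf : Function.Surjective f :=
    (Function.surjective_eval P).comp ((Function.surjective_eval
      (β := fun q : (Nat.card N).primeFactors => ∀ P : Sylow q N, P) p').comp e.symm.surjective)
  have hcard : Nat.card f.ker = (P : Subgroup N).index := by
    have h1 := f.ker.card_mul_index
    rw [Subgroup.index_ker, MonoidHom.range_eq_top.2 hf, Subgroup.card_top,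
      ← (P : Subgroup N).card_mul_index, mul_comm] at h1
    exact Nat.eq_of_mul_eq_mul_left Nat.card_pos h1
  have hcop : p.Coprime (Nat.card f.ker) := by
    rw [hcard, hp.coprime_iff_not_dvd]
    exact P.not_dvd_index
  have hker : ∀ x ∈ f.ker, x ^ Nat.card f.ker = 1 := fun x hx =>
    congrArg Subtype.val (pow_card_eq_one' (x := (⟨x, hx⟩ : f.ker)))
  refine ⟨Nat.card f.ker, f.ker, hcop, ?_, hker, fun x => ?_⟩
  -- `K` consists of the elements of order prime to `p`, a condition preserved by automorphisms.
  · refine Subgroup.characteristic_iff_le_comap.2 fun φ x hx => ?_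
    obtain ⟨k, hk⟩ := P.isPGroup'.exists_pow_pow_eq_one (f (φ x))
    refine orderOf_eq_one_iff.1 (Nat.eq_one_of_dvd_coprimes (hcop.pow_left k)
      (orderOf_dvd_of_pow_eq_one hk) (orderOf_dvd_of_pow_eq_one ?_))
    rw [← map_pow, ← map_pow, hker x hx, map_one, map_one]
  · obtain ⟨k, hk⟩ := P.isPGroup'.exists_pow_pow_eq_one (f x)
    exact ⟨k, by rw [MonoidHom.mem_ker, map_pow, hk]⟩

/-- Fitting's theorem for finite groups. The normal cores `O_q(G)` of the Sylow subgroups commute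
pairwise, so the subgroup they generate is nilpotent; it contains every nilpotent normal subgroup
`H`, because the Sylow subgroups of `H` are characteristic in `H`. -/
theorem fittingSubgroup_isNilpotent (G : Type*) [Group G] [Finite G] :
    Group.IsNilpotent (fittingSubgroup G) := by
  have hfact (q : (Nat.card G).primeFactors) : Fact (q : ℕ).Prime :=
    ⟨Nat.prime_of_mem_primeFactors q.2⟩
  let O (q : (Nat.card G).primeFactors) : Subgroup G :=
    ((default : Sylow q G) : Subgroup G).normalCore
  have hO (q : (Nat.card G).primeFactors) : IsPGroup q (O q) := (default : Sylow q G).isPGroup'.to_le (Subgroup.normalCore_le _)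
  have hnil (q : (Nat.card G).primeFactors) : Group.IsNilpotent (O q) := (hO q).isNilpotent
  have hcomm : Pairwise fun q r => ∀ x y : G, x ∈ O q → y ∈ O r → Commute x y := fun q r hqr =>
    Subgroup.commute_of_normal_of_disjoint _ _ inferInstance inferInstance
      (IsPGroup.disjoint_of_ne _ _ (fun h => hqr (Subtype.ext h)) _ _ (hO q) (hO r))
  have hJ : Group.IsNilpotent (⨆ q, O q : Subgroup G) := by
    rw [← Subgroup.noncommPiCoprod_range (hcomm := hcomm)]
    exact Group.nilpotent_of_surjective _ (Subgroup.noncommPiCoprod hcomm).rangeRestrict_surjective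
  have hle : fittingSubgroup G ≤ ⨆ q, O q := by
    refine sSup_le fun H ⟨hHn, hH⟩ => Subgroup.relIndex_eq_one.1 ?_
    by_contra hne
    obtain ⟨q, hq, hqd⟩ := Nat.exists_prime_and_dvd hne
    have hqG : q ∣ Nat.card G :=
      (hqd.trans (Subgroup.index_dvd_card _)).trans (Subgroup.card_subgroup_dvd_card H)
    let q' : (Nat.card G).primeFactors := ⟨q, Nat.mem_primeFactors.2 ⟨hq, hqG, Nat.card_pos.ne'⟩⟩
    have : Fact q.Prime := ⟨hq⟩
    let Q : Sylow q H := default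
    have : (Q : Subgroup H).Characteristic := Q.characteristic_of_normal inferInstance
    have hQ : (Q : Subgroup H).map H.subtype ≤ O q' :=
      Subgroup.normal_le_normalCore.2 ((Q.isPGroup'.map _).le_sylow_of_normal _)
    have hQJ : (Q : Subgroup H) ≤ (⨆ q, O q).subgroupOf H :=
      Subgroup.map_le_iff_le_comap.1 (hQ.trans (le_iSup O q'))
    exact Q.not_dvd_index (hqd.trans (Subgroup.index_dvd_of_le hQJ))
  exact Group.nilpotent_of_mulEquiv (Subgroup.subgroupOfEquivOfLe hle)

/-! ### Camina pairs whose quotient is a `p`-group -/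

namespace IsCaminaPair

variable {G : Type*} [Group G] {N : Subgroup G} [N.Normal]

theorem le_or_le (hN : IsCaminaPair N) (H : Subgroup G) [hH : H.Normal] : H ≤ N ∨ N ≤ H := by
  refine or_iff_not_imp_left.2 fun h n hn => ?_
  obtain ⟨x, hxH, hxN⟩ := SetLike.not_le_iff_exists.1 h
  obtain ⟨c, hc⟩ := isConj_iff.1 (hN.isConj_mul x hxN n hn)
  exact (Subgroup.mul_mem_cancel_left H hxH).1 (hc ▸ hH.conj_mem x hxH c)

/-- Elements outside `N` have `p`-power order: such an `x` is congruent modulo `N`, hence conjugate,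
to its `p`-part. -/
theorem exists_pow_pow_eq_one [Finite G] (hN : IsCaminaPair N) {p : ℕ} (hp : p.Prime)
    (hGN : IsPGroup p (G ⧸ N)) {x : G} (hx : x ∉ N) : ∃ k, x ^ p ^ k = 1 := by
  have : Fact p.Prime := ⟨hp⟩
  obtain ⟨b, hb⟩ := IsPGroup.iff_card.1 hGN
  -- With `t ≡ 1` modulo `|G / N|` and `t ≡ 0` modulo the `p'`-part of `|G|`, the power `x ^ t` is a
  -- `p`-element in the coset `xN`.
  let m := ordCompl[p] (Nat.card G)
  have hcop : (p ^ b).Coprime m :=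
    (Nat.coprime_ordCompl hp Nat.card_pos.ne').pow_left b
  obtain ⟨t, ht1, ht0⟩ := Nat.chineseRemainder hcop 1 0
  have hmem : x⁻¹ * x ^ t ∈ N := by
    rw [← QuotientGroup.eq, QuotientGroup.mk_pow]
    have h := pow_eq_pow_of_modEq ht1 (x := (x : G ⧸ N)) (by rw [← hb, pow_card_eq_one'])
    rw [h, pow_one]
  have hconj := hN.isConj_mul x hx _ hmem
  rw [mul_inv_cancel_left] at hconj
  refine ⟨(Nat.card G).factorization p, ?_⟩
  obtain ⟨s, hs⟩ := (Nat.modEq_zero_iff_dvd).1 ht0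
  have h1 : (x ^ t) ^ p ^ (Nat.card G).factorization p = 1 := by
    rw [hs, ← pow_mul, mul_right_comm, mul_comm m, Nat.ordProj_mul_ordCompl_eq_self, pow_mul,
      pow_card_eq_one', one_pow]
  have h2 := hconj.pow (p ^ (Nat.card G).factorization p)
  rw [h1, isConj_one_left] at h2
  exact h2

/-- An element outside `N` centralizes no nontrivial `p'`-element of `N`: both `x` and `x * v` have
`p`-power order, hence so does `v`. -/
theorem eq_one_of_commute [Finite G] (hN : IsCaminaPair N) {p : ℕ} (hp : p.Prime)
    (hGN : IsPGroup p (G ⧸ N)) {x v : G} {m : ℕ} (hx : x ∉ N) (hv : v ∈ N) (hxv : Commute x v)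
    (hm : p.Coprime m) (hvm : v ^ m = 1) : v = 1 := by
  obtain ⟨k, hk⟩ := hN.exists_pow_pow_eq_one hp hGN hx
  obtain ⟨l, hl⟩ := hN.exists_pow_pow_eq_one hp hGN
    (fun h => hx ((Subgroup.mul_mem_cancel_right N hv).1 h) : x * v ∉ N)
  have h : v ^ p ^ (k + l) = 1 := by
    have h1 : (x * v) ^ p ^ (k + l) = 1 := by rw [pow_add, mul_comm, pow_mul, hl, one_pow]
    rwa [hxv.mul_pow, pow_add, pow_mul, hk, one_pow, one_mul, ← pow_add] at h1
  exact orderOf_eq_one_iff.1 (Nat.eq_one_of_dvd_coprimes (hm.pow_left _)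
    (orderOf_dvd_of_pow_eq_one h) (orderOf_dvd_of_pow_eq_one hvm))

open scoped commutatorElement in
/-- If some nontrivial element of `G / N` is a power of every nontrivial element, then a lift `x` of
it is central modulo `[N, G]`. As `x` is conjugate to `x * n` for all `n ∈ N`, this gives
`[N, G] = N`. -/
theorem commutator_top_eq (hN : IsCaminaPair N) {z : G ⧸ N} (hz : z ≠ 1)
    (hzy : ∀ y : G ⧸ N, y ≠ 1 → z ∈ Subgroup.zpowers y) : ⁅N, (⊤ : Subgroup G)⁆ = N := by
  obtain ⟨x, rfl⟩ := QuotientGroup.mk_surjective z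
  have hx : x ∉ N := fun h => hz ((QuotientGroup.eq_one_iff x).2 h)
  have hcomm : ∀ y : G, ⁅y, x⁆ ∈ ⁅N, (⊤ : Subgroup G)⁆ := by
    intro y
    by_cases hy : y ∈ N
    · exact Subgroup.commutator_mem_commutator hy (Subgroup.mem_top x)
    · obtain ⟨k, hk⟩ := Subgroup.mem_zpowers_iff.1
        (hzy y fun h => hy ((QuotientGroup.eq_one_iff y).1 h))
      have hn : (y ^ k)⁻¹ * x ∈ N := by
        rw [← QuotientGroup.eq, QuotientGroup.mk_zpow, hk]
      obtain ⟨n, hn', rfl⟩ : ∃ n ∈ N, y ^ k * n = x := ⟨_, hn, mul_inv_cancel_left _ _⟩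
      have e : ⁅y, y ^ k * n⁆ = y ^ k * ⁅n, y⁆⁻¹ * (y ^ k)⁻¹ := by
        simp only [commutatorElement_def]
        group
      rw [e]
      exact Subgroup.Normal.conj_mem inferInstance _
        (inv_mem (Subgroup.commutator_mem_commutator hn' (Subgroup.mem_top y))) _
  refine le_antisymm (Subgroup.commutator_le_left N ⊤) fun n hn => ?_
  obtain ⟨c, hc⟩ := isConj_iff.1 (hN.isConj_mul x hx n hn)
  have e : n = x⁻¹ * ⁅c, x⁆ * x⁻¹⁻¹ := by
    rw [commutatorElement_def, hc]
    group
  rw [e]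
  exact Subgroup.Normal.conj_mem inferInstance _ (hcomm c) _

theorem not_isNilpotent [Finite G] (hN : IsCaminaPair N) {p : ℕ} (hp : p.Prime)
    (hGN : IsPGroup p (G ⧸ N)) (hpN : p ∣ Nat.card N) (hNp : ¬ IsPGroup p N) :
    ¬ Group.IsNilpotent N := by
  intro hnil
  have : Fact p.Prime := ⟨hp⟩
  obtain ⟨m, K, hm, hKc, hKm, hKp⟩ := Group.IsNilpotent.exists_pComplement (N := N) hp hpN
  have hKbot : K ≠ ⊥ := fun h => hNp (isPGroup_iff_pow_pow_eq_one.2 fun g => by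
    simpa [h] using hKp g)
  -- `V` is the group `K ∩ Z(N)`, on which conjugation factors through `G / N`.
  let V : Subgroup G := K.map N.subtype ⊓ Subgroup.centralizer N
  have hVN : V ≤ N := inf_le_left.trans (Subgroup.map_subtype_le K)
  have hVm : ∀ v ∈ V, v ^ m = 1 := by
    rintro _ ⟨⟨v, hv, rfl⟩, -⟩
    exact congrArg Subtype.val (hKm v hv)
  have hfpf : ∀ g ∉ N, ∀ v ∈ V, Commute g v → v = 1 := fun g hg v hv hgv =>
    hN.eq_one_of_commute hp hGN hg (hVN hv) hgv hm (hVm v hv)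
  let _ : CommGroup V :=
    { (inferInstance : Group V) with
      mul_comm := fun a b => Subtype.ext (b.2.2 a (hVN a.2)) }
  let ρ₀ : G →* AddMonoid.End (Additive V) :=
    { toFun := fun g => (MulAut.conjNormal g : MulAut V).toMonoidHom.toAdditive
      map_one' := by
        rw [map_one]
        rfl
      map_mul' := fun a b => by
        rw [map_mul]
        rfl }
  have hρ₀ (g : G) (v : V) : ((ρ₀ g (Additive.ofMul v)).toMul : G) = g * v * g⁻¹ :=
    MulAut.conjNormal_apply g v
  let ρ : G ⧸ N →* AddMonoid.End (Additive V) := QuotientGroup.lift N ρ₀ fun n hn => by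
    ext v
    refine (hρ₀ n v.toMul).trans ?_
    rw [v.toMul.2.2 n hn, mul_inv_cancel_right]
    rfl
  have hρ : ∀ h : G ⧸ N, h ≠ 1 → h ^ p = 1 → ∑ i ∈ Finset.range p, ρ h ^ i = 0 := by
    intro h h1 hhp
    refine AddMonoid.End.sum_pow_eq_zero (by rw [← map_pow, hhp, map_one]) fun v hv => ?_
    obtain ⟨g, rfl⟩ := QuotientGroup.mk_surjective h
    refine Subtype.ext (hfpf g (fun hg => h1 ((QuotientGroup.eq_one_iff g).2 hg)) _ v.toMul.2 ?_)
    exact mul_inv_eq_iff_eq_mul.1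
      ((hρ₀ g v.toMul).symm.trans (congrArg (fun w : Additive V => (w.toMul : G)) hv))
  have hVbot : ∃ v ∈ V, v ≠ 1 := by
    obtain ⟨⟨v, hvK, hvc⟩, hv1⟩ :=
      Subgroup.ne_bot_iff_exists_ne_one.1 (Subgroup.inf_center_ne_bot hKbot)
    refine ⟨v, ⟨⟨v, hvK, rfl⟩, fun n hn => ?_⟩, fun h => hv1 (Subtype.ext (Subtype.ext h))⟩
    exact congrArg Subtype.val (Subgroup.mem_center_iff.1 hvc ⟨n, hn⟩)
  have hpR : (p : AddMonoid.End (Additive V)) ≠ 0 := by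
    intro h0
    obtain ⟨v, hv, hv1⟩ := hVbot
    have h1 : p • Additive.ofMul (⟨v, hv⟩ : V) = 0 := by
      rw [← AddMonoid.End.natCast_apply, h0]
      rfl
    have h2 : v ^ p = 1 := congrArg (fun w : Additive V => (w.toMul : G)) h1
    exact hv1 (orderOf_eq_one_iff.1 (Nat.eq_one_of_dvd_coprimes hm
      (orderOf_dvd_of_pow_eq_one h2) (orderOf_dvd_of_pow_eq_one (hVm v hv))))
  have : Nontrivial (G ⧸ N) := QuotientGroup.nontrivial_iff.2 hN.ne_top
  obtain ⟨z, hz, hzy⟩ := hGN.exists_forall_mem_zpowers ρ hp hpR hρ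
  have hcomm := hN.commutator_top_eq hz hzy
  -- `G / K` is a `p`-group, so the image of `N = [N, G]` in it is trivial, that is, `N = K`.
  let L : Subgroup G := K.map N.subtype
  have hGL : IsPGroup p (G ⧸ L) := by
    refine isPGroup_iff_pow_pow_eq_one.2 fun g => ?_
    obtain ⟨g, rfl⟩ := QuotientGroup.mk_surjective g
    obtain ⟨k, hk⟩ := hGN.exists_pow_pow_eq_one (g : G ⧸ N)
    rw [← QuotientGroup.mk_pow, QuotientGroup.eq_one_iff] at hk
    obtain ⟨l, hl⟩ := hKp ⟨_, hk⟩
    refine ⟨k + l, ?_⟩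
    rw [← QuotientGroup.mk_pow, QuotientGroup.eq_one_iff, pow_add, pow_mul]
    exact ⟨_, hl, rfl⟩
  have : Group.IsNilpotent (G ⧸ L) := hGL.isNilpotent
  have hmap : N.map (QuotientGroup.mk' L) = ⊥ := by
    apply Subgroup.eq_bot_of_commutator_top_eq
    rw [← Subgroup.map_top_of_surjective _ (QuotientGroup.mk'_surjective L),
      ← Subgroup.map_commutator, hcomm]
  rw [Subgroup.map_eq_bot_iff, QuotientGroup.ker_mk'] at hmap
  -- An element of order `p` in `N` contradicts `N = K`.
  obtain ⟨x, hx⟩ := exists_prime_orderOf_dvd_card' p hpN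
  obtain ⟨y, hyK, hyx⟩ := hmap x.2
  obtain rfl : y = x := Subtype.ext hyx
  have hdvd := orderOf_dvd_of_pow_eq_one (hKm y hyK)
  rw [hx] at hdvd
  exact hp.one_lt.ne' (Nat.eq_one_of_dvd_coprimes hm dvd_rfl hdvd)

end IsCaminaPair

theorem corollary3p4 {G : Type*} [Group G] [Finite G] (N : Subgroup G) [N.Normal]
    (hN : IsCaminaPairTypeFour N) : fittingSubgroup G < N := by
  obtain ⟨p, hp, hGN, hpN, hNp⟩ := hN.exists_prime
  have hnil := hN.toIsCaminaPair.not_isNilpotent hp hGN hpN hNp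
  have hH : ∀ H : Subgroup G, Group.IsNilpotent H → ¬ N ≤ H := fun H hH hNH =>
    hnil (Group.nilpotent_of_mulEquiv (Subgroup.subgroupOfEquivOfLe hNH))
  refine lt_of_le_of_ne (sSup_le fun H ⟨hHn, hHnil⟩ => ?_) fun h =>
    hH _ (fittingSubgroup_isNilpotent G) h.ge
  exact (hN.toIsCaminaPair.le_or_le H).resolve_right (hH H hHnil)
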